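/- All state, control and output spaces are Polish spaces with their Borel $\sigma$-algebras; the common output space $\mathbb Y$ carries a metric $\mathbf d_{\mathbb Y}$ inducing its topology. A general Markov decision process $\mathbf M=(\mathbb X,\pi,\mathbb T,\mathbb A,h,\mathbb Y)$ consists of a state space $\mathbb X$, a control space $\mathbb A$, an initial probability measure $\pi$ on $\mathbb X$, a Borel stochastic kernel $\mathbb T(\cdot\mid x,u)$ on $\mathbb X$ given $\mathbb X\times\mathbb A$, and a measurable output map $h:\mathbb X\to\mathbb Y$. For a probability measure $p$ on $\mathbb A$ write $\mathbb T(\cdot\mid x,p)=\int_{\mathbb A}\mathbb T(\cdot\mid x,u)\,p(du)$. A Markov policy is a sequence $\mu=(\mu_0,\mu_1,\dots)$ of universally measurable maps from $\mathbb X$ to the probability measures on $\mathbb A$. Under $\mu$ the state process satisfies $x(0)\sim\pi$ and $x(t+1)\sim\mathbb T(\cdot\mid x(t),\mu_t(x(t)))$; for measurable $K\subseteq\mathbb Y$ let $r^\mu(K_{\mathbb X},N)$ be the probability that $h(x(t))\in K$ for some $t\in\{0,\dots,N\}$. Let $\epsilon,\delta\in\mathbb R$. For a Borel relation $\mathcal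 R\subseteq\mathbb X\times\mathbb X'$, a probability measure $\mathbb W$ on $\mathbb X\times\mathbb X'$ is a $\delta$-lifting of a pair $(\Delta,\Theta)$ of probability measures on $\mathbb X$ and $\mathbb X'$ if it has marginals $\Delta$ and $\Theta$ and $\mathbb W(\mathcal R)\ge 1-\delta$. We write $\mathbf M\preceq^\delta_\epsilon\mathbf M'$, or $\mathbf M'\succeq^\delta_\epsilon\mathbf M$, for $\mathbf M=(\mathbb X,\pi,\mathbb T,\mathbb A,h,\mathbb Y)$ and $\mathbf M'=(\mathbb X',\pi',\mathbb T',\mathbb A',h',\mathbb Y)$, if there are a Borel measurable interface function $\mathcal U$ from $\mathbb A\times\mathbb X\times\mathbb X'$ to the probability measures on $\mathbb A'$, a Borel relation $\mathcal R\subseteq\mathbb X\times\mathbb X'$ and a Borel stochastic kernel $\mathbb W_{\mathbb T}(\cdot\mid u,x,x')$ on $\mathbb X\times\mathbb X'$ such that: $\mathbf d_{\mathbb Y}(h(x),h'(x'))\le\epsilon$ for all $(x,x')\in\mathcal R$; for all $(x,x')\in\mathcal R$ and $u\in\mathbb A$, $\mathbb W_{\mathbb T}(\cdot\mid u,x,x')$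 is a $\delta$-lifting of $\mathbb T(\cdot\mid x,u)$ and $\mathbb T'(\cdot\mid x',\mathcal U(u,x,x'))$; and $(\pi,\pi')$ has a $\delta$-lifting. Theorem. Let $\mathbf M_1=(\mathbb X_1,\pi_1,\mathbb T_1,\mathbb A_1,h_1,\mathbb Y)$ and $\mathbf M_2=(\mathbb X_2,\pi_2,\mathbb T_2,\mathbb A_2,h_2,\mathbb Y)$ satisfy $\mathbf M_1\succeq_\epsilon^\delta\mathbf M_2$, let $K\subseteq\mathbb Y$ be measurable and $N\in\mathbb N$. Put $K^{-\epsilon}=\{z\in\mathbb Y:\ \exists y\in K,\ \mathbf d_{\mathbb Y}(y,z)\le\epsilon\}$, $K^{-\epsilon}_{\mathbb X_1}=h_1^{-1}(K^{-\epsilon})$ and $\mathbf L(r)=\min(1,\max(0,r))$. Define $V_N=0$ and, for $k=N-1,\dots,0$, $$V_k(x)=\sup_{\nu}\ \mathbf L\Big(\int_{\mathbb X_1}\big[\mathbf 1_{K^{-\epsilon}_{\mathbb X_1}}(\bar x)+\mathbf 1_{\mathbb X_1\setminus K^{-\epsilon}_{\mathbb X_1}}(\bar x)\,V_{k+1}(\bar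 x)\big]\,\mathbb T_1(d\bar x\mid x,\nu(x))+\delta\Big),$$ where $\nu$ ranges over the universally measurable maps from $\mathbb X_1$ to the probability measures on $\mathbb A_1$. Then $K^{-\epsilon}_{\mathbb X_1}$ is universally measurable and every $V_k$, $0\le k\le N$, is a universally measurable function $\mathbb X_1\to[0,1]$ (so all integrals are well defined), and for every Markov policy $\mu$ for $\mathbf M_2$ $$r^\mu(K_{\mathbb X_2},N)\ \le\ \mathbf L\Big(\int_{\mathbb X_1}\big[\mathbf 1_{K^{-\epsilon}_{\mathbb X_1}}(x)+\mathbf 1_{\mathbb X_1\setminus K^{-\epsilon}_{\mathbb X_1}}(x)\,V_0(x)\big]\,\pi_1(dx)+\delta\Big).$$ -/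

import Mathlib

open MeasureTheory ProbabilityTheory

/-- A map between measurable spaces is universally measurable if preimages of measurable sets are
measurable for the completion of every probability measure on the domain. -/
def UniversallyMeasurable {α β : Type*} [MeasurableSpace α] [MeasurableSpace β]
    (f : α → β) : Prop :=
  ∀ m : Measure α, IsProbabilityMeasure m → NullMeasurable f m

/-- A set is universally measurable if it is measurable for the completion of every
probability measure. -/
def UniversallyMeasurableSet {α : Type*} [MeasurableSpace α] (s : Set α) : Prop :=
  ∀ m : Measure α, IsProbabilityMeasure m → NullMeasurableSet s m

/-- A general Markov decision process with state space `X`, control space `A` and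
output space `Y`: an initial probability measure, a stochastic kernel on `X` given a state and a
control, and a measurable output map. -/
structure GMDP (X A Y : Type*) [MeasurableSpace X] [MeasurableSpace A] [MeasurableSpace Y] where
  /-- the initial probability measure -/
  init : ProbabilityMeasure X
  /-- the transition kernel -/
  trans : Kernel (X × A) X
  isMarkovKernel_trans : IsMarkovKernel trans
  /-- the output map -/
  out : X → Y
  measurable_out : Measurable out

/-- A Markov policy: a sequence of universally measurable maps from states to probability measures
on the controls. -/
structure MarkovPolicy (X A : Type*) [MeasurableSpace X] [MeasurableSpace A] where
  /-- the distribution of the control that is applied at a given time in a given state -/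
  act : ℕ → X → ProbabilityMeasure A
  universallyMeasurable_act : ∀ t, UniversallyMeasurable (act t)

/-- `W` is a lifting of the pair `(Δ, Θ)` for the relation `R`: its marginals are `Δ` and `Θ`, and
it gives probability at least `1 - δ` to `R`. -/
structure IsLifting {X₁ X₂ : Type*} [MeasurableSpace X₁] [MeasurableSpace X₂]
    (R : Set (X₁ × X₂)) (δ : ℝ) (Δ : Measure X₁) (Θ : Measure X₂) (W : Measure (X₁ × X₂)) :
    Prop where
  isProbabilityMeasure : IsProbabilityMeasure W
  fst_marginal : ∀ S : Set X₁, MeasurableSet S → W (S ×ˢ Set.univ) = Δ S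
  snd_marginal : ∀ S : Set X₂, MeasurableSet S → W (Set.univ ×ˢ S) = Θ S
  relation_prob : 1 - δ ≤ W.real R

/-- The closed `ε`-dilation of a set: all points at distance at most `ε` from some point of the
set. For a translation-invariant metric on an additive group, this is the set of all sums `y + e`
with `y ∈ K` and `dist 0 e ≤ ε`. -/
def dilation {Y : Type*} [MetricSpace Y] (ε : ℝ) (K : Set Y) : Set Y :=
  {z | ∃ y ∈ K, dist y z ≤ ε}

/-- Truncation of a real number to the unit interval. -/
def trunc (r : ℝ) : ℝ := min 1 (max 0 r)

namespace GMDP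

section Single

variable {X A Y : Type*} [MeasurableSpace X] [MeasurableSpace A] [MeasurableSpace Y]

/-- The law of the next state from `x` when the control is drawn from `p`, that is
`∫ T(· | x, u) p(du)`. -/
noncomputable def step (M : GMDP X A Y) (x : X) (p : Measure A) : Measure X :=
  p.bind fun u => M.trans (x, u)

/-- The law of the path `(x(0), …, x(n))` of the process controlled by a Markov policy. -/
noncomputable def pathLaw (M : GMDP X A Y) (μ : MarkovPolicy X A) :
    (n : ℕ) → Measure (Fin (n + 1) → X)
  | 0 => (M.init : Measure X).map fun x _ => x
  | n + 1 => (M.pathLaw μ n).bind fun ω =>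
      (M.step (ω (Fin.last n)) (μ.act n (ω (Fin.last n)))).map
        fun x' => (Fin.snoc ω x' : Fin (n + 2) → X)

/-- The probability that the output trace is in `K` at some time in `{0, …, N}` when a Markov
policy is used. -/
noncomputable def reachProb (M : GMDP X A Y) (μ : MarkovPolicy X A) (K : Set Y) (N : ℕ) : ℝ :=
  (M.pathLaw μ N).real {ω | ∃ t : Fin (N + 1), M.out (ω t) ∈ K}

/-- The function that is `1` on `D` and equals `V` off `D`. -/
noncomputable def reachIntegrand (D : Set X) (V : X → ℝ) (x : X) : ℝ :=
  D.indicator (fun _ => 1) x + Dᶜ.indicator V x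

/-- The truncated one-step operator with slack `δ`, for target set `D` and decision rule `ν`. -/
noncomputable def upperOp (M : GMDP X A Y) (D : Set X) (δ : ℝ) (ν : X → ProbabilityMeasure A)
    (V : X → ℝ) (x : X) : ℝ :=
  trunc ((∫ x', reachIntegrand D V x' ∂(M.step x (ν x))) + δ)

/-- The supremum of the truncated one-step operators over all universally measurable
decision rules. -/
noncomputable def upperBellman (M : GMDP X A Y) (D : Set X) (δ : ℝ) (V : X → ℝ) (x : X) : ℝ :=
  ⨆ ν : {ν : X → ProbabilityMeasure A // UniversallyMeasurable ν}, M.upperOp D δ ν V x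

/-- The upper reachability value obtained from the value function `V₀` at time `0`. -/
noncomputable def upperReach (M : GMDP X A Y) (D : Set X) (δ : ℝ) (V₀ : X → ℝ) : ℝ :=
  trunc ((∫ x, reachIntegrand D V₀ x ∂(M.init : Measure X)) + δ)

end Single

/-- `M₁` is `(ε, δ)`-stochastically simulated by `M₂`, written `M₁ ⪯ M₂`. The kernel `U` is the
interface function, which refines a control of `M₁` to a random control of `M₂`. -/
def IsSimulatedBy {X₁ A₁ X₂ A₂ Y : Type*} [MeasurableSpace X₁] [MeasurableSpace A₁]
    [MeasurableSpace X₂] [MeasurableSpace A₂] [MetricSpace Y] [MeasurableSpace Y]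
    (ε δ : ℝ) (M₁ : GMDP X₁ A₁ Y) (M₂ : GMDP X₂ A₂ Y) : Prop :=
  ∃ (U : Kernel (A₁ × X₁ × X₂) A₂) (R : Set (X₁ × X₂)) (W : Kernel (A₁ × X₁ × X₂) (X₁ × X₂)),
    IsMarkovKernel U ∧ IsMarkovKernel W ∧ MeasurableSet R ∧
    (∀ x₁ x₂, (x₁, x₂) ∈ R → dist (M₁.out x₁) (M₂.out x₂) ≤ ε) ∧
    (∀ x₁ x₂, (x₁, x₂) ∈ R → ∀ u₁ : A₁,
      IsLifting R δ (M₁.trans (x₁, u₁)) (M₂.step x₂ (U (u₁, x₁, x₂))) (W (u₁, x₁, x₂))) ∧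
    ∃ W₀ : Measure (X₁ × X₂), IsLifting R δ (M₁.init : Measure X₁) (M₂.init : Measure X₂) W₀

end GMDP

/-! There are two issues: measurability of `V k`, and the comparison of the two processes.

Measurability. The dilation of `K` is a projection, hence analytic but perhaps not Borel, so Borel
functions are replaced by upper semianalytic ones. The Bellman operator preserves this class:
integration against a Borel kernel does (`UpperSemianalytic.integral_kernel`), and averaging over
controls never beats the best single control, so the supremum over rules is one over controls and
its level sets are projections (`lt_upperBellman_iff`). Analytic sets are universally measurable by
a capacitability argument (`AnalyticSet.nullMeasurableSet`).

Comparison. The reach probability of `M₂` obeys a backward recursion `hitProb`. Along the relation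
it is at most `V k`, by backward induction: for each control `u` of `M₂`, the lifting moves the
integral to `M₁` at a cost of at most `δ` (`IsLifting.lintegral_le_ofReal_trunc`), and the constant
rule with value given by the interface at `u` competes in the supremum. The bound is the same for
all `u`, so it survives averaging over the policy, and no measurable selection is needed. The
initial lifting costs the last `δ`. -/

open Set Filter Topology

open scoped ENNReal

/-! ### Closure properties of analytic sets. -/

namespace MeasureTheory.AnalyticSet

variable {α β : Type*} [TopologicalSpace α] [TopologicalSpace β]

theorem inter [T2Space α] {s t : Set α} (hs : AnalyticSet s) (ht : AnalyticSet t) :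
    AnalyticSet (s ∩ t) := by
  rw [inter_eq_iInter]
  exact AnalyticSet.iInter fun b => by cases b <;> assumption

theorem union {s t : Set α} (hs : AnalyticSet s) (ht : AnalyticSet t) :
    AnalyticSet (s ∪ t) := by
  rw [union_eq_iUnion]
  exact AnalyticSet.iUnion fun b => by cases b <;> assumption

theorem prod [PolishSpace α] [PolishSpace β] {s : Set α} {t : Set β} (hs : AnalyticSet s)
    (ht : AnalyticSet t) : AnalyticSet (s ×ˢ t) :=
  (hs.preimage continuous_fst).inter (ht.preimage continuous_snd)

/-- The graph of `f` is Borel, and the preimage is the projection of its part above `s`. -/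
theorem preimage_of_measurable [PolishSpace α] [MeasurableSpace α] [BorelSpace α]
    [PolishSpace β] [MeasurableSpace β] [BorelSpace β] {s : Set β} (hs : AnalyticSet s)
    {f : α → β} (hf : Measurable f) : AnalyticSet (f ⁻¹' s) := by
  have hgraph : MeasurableSet {p : α × β | f p.1 = p.2} :=
    measurableSet_eq_fun (hf.comp measurable_fst) measurable_snd
  convert (hgraph.analyticSet.inter (hs.preimage continuous_snd)).image_of_continuous
    continuous_fst
  ext x
  simp

end MeasureTheory.AnalyticSet

/-! ### Capacitability: measures of analytic sets. -/

/-- The sequences of natural numbers whose first `n` terms are bounded by those of `b`. -/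
def natBox (n : ℕ) (b : ℕ → ℕ) : Set (ℕ → ℕ) := {x | ∀ i < n, x i ≤ b i}

theorem natBox_zero (b : ℕ → ℕ) : natBox 0 b = univ := by simp [natBox]

theorem natBox_antitone (b : ℕ → ℕ) : Antitone fun n => natBox n b :=
  fun _ _ hmn _ hx i hi => hx i (hi.trans_le hmn)

theorem natBox_congr {n : ℕ} {b b' : ℕ → ℕ} (h : ∀ i < n, b i = b' i) :
    natBox n b = natBox n b' := by
  ext x
  exact forall₂_congr fun i hi => by rw [h i hi]

/-- The bounds are chosen one coordinate at a time. Continuity from below along increasing unions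
holds for arbitrary sets, so `f` can be any function. -/
theorem exists_forall_lt_measure_image_natBox {α : Type*} [MeasurableSpace α] (m : Measure α)
    (f : (ℕ → ℕ) → α) {c : ℝ≥0∞} (hc : c < m (range f)) :
    ∃ b : ℕ → ℕ, ∀ n, c < m (f '' natBox n b) := by
  have hstep : ∀ (n : ℕ) (b : ℕ → ℕ), c < m (f '' natBox n b) →
      ∃ k, c < m (f '' natBox (n + 1) (Function.update b n k)) := by
    intro n b hb
    have hmono : Monotone fun k => f '' natBox (n + 1) (Function.update b n k) := by
      refine fun k l hkl => image_mono fun x hx i hi => (hx i hi).trans ?_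
      exact Function.update_mono hkl i
    have hunion : ⋃ k, f '' natBox (n + 1) (Function.update b n k) = f '' natBox n b := by
      rw [← image_iUnion]
      congr 1
      ext x
      simp only [mem_iUnion]
      constructor
      · rintro ⟨k, hx⟩ i hi
        simpa [hi.ne] using hx i (by omega)
      · refine fun hx => ⟨x n, fun i hi => ?_⟩
        rcases eq_or_ne i n with rfl | hin
        · simp
        · simpa [hin] using hx i (by omega)
    rw [← hunion, hmono.measure_iUnion] at hb
    exact lt_iSup_iff.1 hb
  choose! k hk using hstep
  let s : ℕ → ℕ → ℕ := fun n => Nat.rec (fun _ => 0) (fun n b => Function.update b n (k n b)) n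
  have hs : ∀ n, s (n + 1) = Function.update (s n) n (k n (s n)) := fun _ => rfl
  have hlt : ∀ n, c < m (f '' natBox n (s n)) := by
    intro n
    induction n with
    | zero => rwa [natBox_zero, image_univ]
    | succ n ih => exact hk n _ ih
  have hstab : ∀ n i, i < n → s n i = s (i + 1) i := by
    intro n i hi
    induction n, hi using Nat.le_induction with
    | base => rfl
    | succ n hn ih =>
      rw [hs, Function.update_of_ne (by omega), ih]
  refine ⟨fun i => s (i + 1) i, fun n => ?_⟩
  rw [← natBox_congr (hstab n)]
  exact hlt n

section

variable {α : Type*} [TopologicalSpace α]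

/-- The closed approximations to the image of the compact set of the sequences bounded by `b`. -/
def natBoxClosure (f : (ℕ → ℕ) → α) (b : ℕ → ℕ) (n : ℕ) : Set α := closure (f '' natBox n b)

theorem natBoxClosure_antitone (f : (ℕ → ℕ) → α) (b : ℕ → ℕ) : Antitone (natBoxClosure f b) :=
  fun _ _ hmn => closure_mono (image_mono (natBox_antitone b hmn))

theorem iInter_natBoxClosure_subset_range [T2Space α] [FirstCountableTopology α]
    {f : (ℕ → ℕ) → α} (hf : Continuous f) (b : ℕ → ℕ) : ⋂ n, natBoxClosure f b n ⊆ range f := by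
  intro y hy
  obtain ⟨U, hU⟩ := (𝓝 y).exists_antitone_basis
  have hex : ∀ n, ∃ x ∈ natBox n b, f x ∈ U n := fun n => by
    obtain ⟨_, hz, x, hx, rfl⟩ := mem_closure_iff_nhds.1 (mem_iInter.1 hy n) (U n) (hU.mem n)
    exact ⟨x, hx, hz⟩
  choose x hxb hxU using hex
  -- Coordinate `i` of `x n` can exceed `b i` only when `n ≤ i`; adding these finitely many values
  -- gives one compact box containing every `x n`.
  let B : ℕ → ℕ := fun i => b i + ∑ n ∈ Finset.range (i + 1), x n i
  have hxB : ∀ n, x n ∈ univ.pi fun i => Iic (B i) := by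
    intro n i _
    by_cases h : i < n
    · exact (hxb n i h).trans (Nat.le_add_right _ _)
    · exact (Finset.single_le_sum (f := fun n => x n i) (fun _ _ => Nat.zero_le _)
        (Finset.mem_range.2 (by omega))).trans (Nat.le_add_left _ _)
  obtain ⟨z, -, φ, hφ, hz⟩ :=
    (isCompact_univ_pi fun i => (finite_Iic (B i)).isCompact).tendsto_subseq hxB
  refine ⟨z, tendsto_nhds_unique ((hf.tendsto z).comp hz) ?_⟩
  exact (hU.tendsto hxU).comp hφ.tendsto_atTop

/-- The right side involves only closed sets and a parameter in Baire space, so it can be projected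
when `m` varies in a kernel. -/
theorem lt_measure_range_iff_exists [T2Space α] [FirstCountableTopology α] [MeasurableSpace α]
    [OpensMeasurableSpace α] (m : Measure α) [IsFiniteMeasure m] {f : (ℕ → ℕ) → α}
    (hf : Continuous f) (c : ℝ≥0∞) :
    c < m (range f) ↔ ∃ b : ℕ → ℕ, c < ⨅ n, m (natBoxClosure f b n) := by
  constructor
  · intro hc
    obtain ⟨c', hcc', hc'⟩ := exists_between hc
    obtain ⟨b, hb⟩ := exists_forall_lt_measure_image_natBox m f hc'
    exact ⟨b, hcc'.trans_le (le_iInf fun n => (hb n).le.trans (measure_mono subset_closure))⟩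
  · rintro ⟨b, hb⟩
    rw [← (natBoxClosure_antitone f b).measure_iInter
      (fun n => isClosed_closure.measurableSet.nullMeasurableSet) ⟨0, measure_ne_top _ _⟩] at hb
    exact hb.trans_le (measure_mono (iInter_natBoxClosure_subset_range hf b))

/-- Analytic sets are measurable for the completion of every finite measure. -/
theorem MeasureTheory.AnalyticSet.nullMeasurableSet [T2Space α] [FirstCountableTopology α]
    [MeasurableSpace α] [OpensMeasurableSpace α] {s : Set α} (hs : AnalyticSet s) (m : Measure α)
    [IsFiniteMeasure m] : NullMeasurableSet s m := by
  rw [AnalyticSet] at hs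
  rcases hs with rfl | ⟨f, hf, rfl⟩
  · exact nullMeasurableSet_empty
  rcases eq_or_ne (m (range f)) 0 with h0 | h0
  · exact NullMeasurableSet.of_null h0
  -- Borel subsets of measure above `c k`, with `c k` tending to the full measure, have a Borel
  -- union that exhausts the range up to a null set.
  obtain ⟨c, -, hc, hlim⟩ := exists_seq_strictMono_tendsto' (pos_iff_ne_zero.2 h0)
  have hex : ∀ k, ∃ b : ℕ → ℕ, c k < ⨅ n, m (natBoxClosure f b n) := fun k =>
    (lt_measure_range_iff_exists m hf _).1 (hc k).2
  choose b hb using hex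
  let t : Set α := ⋃ k, ⋂ n, natBoxClosure f (b k) n
  have ht : MeasurableSet t :=
    .iUnion fun k => .iInter fun n => isClosed_closure.measurableSet
  have hts : t ⊆ range f := iUnion_subset fun k => iInter_natBoxClosure_subset_range hf (b k)
  have hle : m (range f) ≤ m t := by
    refine le_of_tendsto' hlim fun k => ?_
    refine (hb k).le.trans ?_
    rw [← (natBoxClosure_antitone f (b k)).measure_iInter
      (fun n => isClosed_closure.measurableSet.nullMeasurableSet) ⟨0, measure_ne_top _ _⟩]
    exact measure_mono (subset_iUnion (fun k => ⋂ n, natBoxClosure f (b k) n) k)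
  exact ht.nullMeasurableSet.congr
    (ae_eq_of_subset_of_measure_ge hts hle ht.nullMeasurableSet (measure_ne_top _ _))

/-- For an analytic set `s` and a finite kernel `κ`, the function `z ↦ κ z s` is upper
semianalytic. -/
theorem MeasureTheory.AnalyticSet.setOf_lt_kernel {ζ : Type*} [TopologicalSpace ζ] [PolishSpace ζ]
    [MeasurableSpace ζ] [BorelSpace ζ] [T2Space α] [FirstCountableTopology α]
    [MeasurableSpace α] [OpensMeasurableSpace α] {s : Set α} (hs : AnalyticSet s)
    (κ : Kernel ζ α) [IsFiniteKernel κ] (c : ℝ≥0∞) : AnalyticSet {z | c < κ z s} := by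
  rw [AnalyticSet] at hs
  rcases hs with rfl | ⟨f, hf, rfl⟩
  · simpa using analyticSet_empty
  have hmeas : Measurable fun p : ζ × (ℕ → ℕ) => ⨅ n, κ p.1 (natBoxClosure f p.2 n) := by
    refine Measurable.iInf fun n => ?_
    -- The `n`-th closure depends only on the first `n` terms of the bound, a countable parameter,
    -- which gives joint measurability.
    let ext : (Fin n → ℕ) → ℕ → ℕ := fun t i => if h : i < n then t ⟨i, h⟩ else 0
    have h : Measurable fun p : ζ × (Fin n → ℕ) => κ p.1 (natBoxClosure f (ext p.2) n) :=
      measurable_from_prod_countable_left fun t =>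
        κ.measurable_coe (s := natBoxClosure f (ext t) n) isClosed_closure.measurableSet
    have hr : Measurable fun p : ζ × (ℕ → ℕ) => (p.1, fun i : Fin n => p.2 i) := by fun_prop
    convert h.comp hr using 2 with p
    refine congrArg (fun S => κ p.1 (closure (f '' S))) (natBox_congr fun i hi => ?_)
    simp [ext, hi]
  convert (measurableSet_lt (measurable_const (a := c)) hmeas).analyticSet.image_of_continuous
    continuous_fst using 1
  ext z
  simp [lt_measure_range_iff_exists (κ z) hf c]

end

/-! ### Upper semianalytic functions. -/

/-- A real function is upper semianalytic if its strict upper level sets are analytic. -/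
def UpperSemianalytic {α : Type*} [TopologicalSpace α] (g : α → ℝ) : Prop :=
  ∀ c, AnalyticSet {x | c < g x}

namespace UpperSemianalytic

theorem analyticSet_hypograph {α : Type*} [TopologicalSpace α] [PolishSpace α] {g : α → ℝ}
    (hg : UpperSemianalytic g) :
    AnalyticSet {p : α × ℝ | p.2 < g p.1} := by
  have : {p : α × ℝ | p.2 < g p.1} = ⋃ q : ℚ, {x | (q : ℝ) < g x} ×ˢ Iic (q : ℝ) := by
    ext ⟨x, t⟩
    simp only [mem_ofPred_eq, mem_iUnion, mem_prod, mem_Iic]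
    constructor
    · intro h
      obtain ⟨q, hq, hq'⟩ := exists_rat_btwn h
      exact ⟨q, hq', hq.le⟩
    · rintro ⟨q, hq, hq'⟩
      exact hq'.trans_lt hq
  rw [this]
  exact AnalyticSet.iUnion fun q => (hg q).prod measurableSet_Iic.analyticSet

variable {α : Type*} [TopologicalSpace α] [PolishSpace α] [MeasurableSpace α] [BorelSpace α]
  {g : α → ℝ}

theorem nullMeasurable (hg : UpperSemianalytic g) (m : Measure α) [IsFiniteMeasure m] :
    NullMeasurable g m :=
  measurable_of_Ioi (δ := NullMeasurableSpace α m) fun c => (hg c).nullMeasurableSet m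

theorem aemeasurable (hg : UpperSemianalytic g) (m : Measure α) [IsFiniteMeasure m] :
    AEMeasurable g m := (hg.nullMeasurable m).aemeasurable

theorem integrable (hg : UpperSemianalytic g) (h01 : ∀ x, g x ∈ Icc (0 : ℝ) 1) (m : Measure α)
    [IsFiniteMeasure m] : Integrable g m :=
  Integrable.of_bound (hg.aemeasurable m).aestronglyMeasurable 1 <| .of_forall fun x => by
    rw [Real.norm_of_nonneg (h01 x).1]
    exact (h01 x).2

/-- The layer-cake formula turns integrals into masses of an analytic set, to which
`AnalyticSet.setOf_lt_kernel` applies. Restricting to `Ioo 0 1` discards negative heights. -/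
theorem lintegral_eq_measure_hypograph (hg : UpperSemianalytic g)
    (h01 : ∀ x, g x ∈ Icc (0 : ℝ) 1) (m : Measure α) [IsFiniteMeasure m] :
    ∫⁻ x, ENNReal.ofReal (g x) ∂m =
      (m.prod (volume.restrict (Ioo (0 : ℝ) 1))) {p : α × ℝ | p.2 < g p.1} := by
  have hnull := hg.analyticSet_hypograph.nullMeasurableSet
    (m.prod (volume.restrict (Ioo (0 : ℝ) 1)))
  have hae : AEMeasurable ({p : α × ℝ | p.2 < g p.1}.indicator (1 : α × ℝ → ℝ≥0∞))
      (m.prod (volume.restrict (Ioo (0 : ℝ) 1))) := aemeasurable_one.indicator₀ hnull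
  rw [← lintegral_indicator_one₀ hnull, lintegral_prod _ hae]
  refine lintegral_congr fun x => ?_
  have : (fun t : ℝ => {p : α × ℝ | p.2 < g p.1}.indicator (1 : α × ℝ → ℝ≥0∞) (x, t))
      = (Iio (g x)).indicator 1 := rfl
  rw [this, lintegral_indicator_one measurableSet_Iio, Measure.restrict_apply measurableSet_Iio,
    inter_comm, Ioo_inter_Iio, min_eq_right (h01 x).2, Real.volume_Ioo, sub_zero]

/-- Integrating an upper semianalytic function against a Markov kernel gives an upper semianalytic
function. -/
theorem integral_kernel {ζ : Type*} [TopologicalSpace ζ] [PolishSpace ζ]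
    [MeasurableSpace ζ] [BorelSpace ζ] (hg : UpperSemianalytic g)
    (h01 : ∀ x, g x ∈ Icc (0 : ℝ) 1) (κ : Kernel ζ α) [IsFiniteKernel κ] :
    UpperSemianalytic fun z => ∫ x, g x ∂(κ z) := by
  intro c
  rcases lt_or_ge c 0 with hc | hc
  · convert (MeasurableSet.univ (α := ζ)).analyticSet
    exact eq_univ_of_forall fun z => hc.trans_le (integral_nonneg fun x => (h01 x).1)
  · convert hg.analyticSet_hypograph.setOf_lt_kernel
      (κ ×ₖ Kernel.const ζ (volume.restrict (Ioo (0 : ℝ) 1))) (ENNReal.ofReal c) using 3 with z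
    rw [Kernel.prod_apply, Kernel.const_apply, ← hg.lintegral_eq_measure_hypograph h01,
      ← ofReal_integral_eq_lintegral_ofReal (hg.integrable h01 _) (.of_forall fun x => (h01 x).1),
      ENNReal.ofReal_lt_ofReal_iff_of_nonneg hc]

end UpperSemianalytic

/-! ### Universally measurable maps and the Giry σ-algebra. -/

namespace MeasureTheory.ProbabilityMeasure

/-- The Giry σ-algebra on the probability measures on a standard Borel space is countably
generated. -/
instance countablyGenerated {A : Type*} [MeasurableSpace A] [StandardBorelSpace A] :
    MeasurableSpace.CountablyGenerated (ProbabilityMeasure A) := by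
  let e : A → ℝ := embeddingReal A
  have he : MeasurableEmbedding e := measurableEmbedding_embeddingReal A
  let S : Set (Set ℝ) := ⋃ a : ℚ, {Iic (a : ℝ)}
  have hgen : ‹MeasurableSpace A› = .generateFrom (preimage e '' S) := by
    rw [← MeasurableSpace.comap_generateFrom, ← Real.borel_eq_generateFrom_Iic_rat,
      ← BorelSpace.measurable_eq, he.comap_eq]
  have hpi : IsPiSystem (preimage e '' S) := Real.isPiSystem_Iic_rat.comap e
  -- Distribution functions at rationals determine the law on `ℝ`, so the Giry σ-algebra is pulled
  -- back from a countable product.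
  let ev : ProbabilityMeasure A → ℚ → ℝ≥0∞ := fun p q => (p : Measure A) (e ⁻¹' Iic (q : ℝ))
  have hev : (inferInstance : MeasurableSpace (ProbabilityMeasure A)) =
      MeasurableSpace.comap ev inferInstance := by
    refine le_antisymm ?_ ?_
    · have hcoe : Measurable[MeasurableSpace.comap ev inferInstance]
          fun p : ProbabilityMeasure A => (p : Measure A) := by
        refine @Measurable.measure_of_isPiSystem_of_isProbabilityMeasure _ _
          (MeasurableSpace.comap ev inferInstance) _ _ (fun p => p.2) _ hgen hpi ?_
        rintro _ ⟨T, hT, rfl⟩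
        obtain ⟨q, rfl⟩ := mem_iUnion.1 hT
        exact (measurable_pi_apply q).comp (comap_measurable ev)
      exact hcoe.comap_le
    · have : Measurable ev := measurable_pi_lambda _ fun q =>
        (Measure.measurable_coe (he.measurable measurableSet_Iic)).comp measurable_subtype_coe
      exact this.comap_le
  have h := MeasurableSpace.CountablyGenerated.comap (m := inferInstance) ev
  rwa [← hev] at h

end MeasureTheory.ProbabilityMeasure

namespace UniversallyMeasurable

variable {α β γ : Type*} [MeasurableSpace α] [MeasurableSpace β] [MeasurableSpace γ]

/-- Countable generation lets a single null set serve all preimages, which yields a measurable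
modification. -/
theorem aemeasurable [MeasurableSpace.CountablyGenerated β] {f : α → β}
    (hf : UniversallyMeasurable f) (m : Measure α) [hm : IsProbabilityMeasure m] :
    AEMeasurable f m := (hf m hm).aemeasurable

theorem of_aemeasurable {f : α → β}
    (hf : ∀ m : Measure α, IsProbabilityMeasure m → AEMeasurable f m) :
    UniversallyMeasurable f := fun m hm => (hf m hm).nullMeasurable

theorem const (b : β) : UniversallyMeasurable fun _ : α => b :=
  of_aemeasurable fun _ _ => aemeasurable_const

theorem aemeasurable_comp [MeasurableSpace.CountablyGenerated γ] {f : β → γ}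
    (hf : UniversallyMeasurable f) {g : α → β} (hg : Measurable g) (m : Measure α)
    [IsProbabilityMeasure m] : AEMeasurable (fun x => f (g x)) m :=
  have := Measure.isProbabilityMeasure_map (μ := m) hg.aemeasurable
  (hf.aemeasurable (m.map g)).comp_measurable hg

end UniversallyMeasurable

/-! ### Truncation and liftings. -/

section trunc

theorem trunc_mem_Icc (r : ℝ) : trunc r ∈ Icc (0 : ℝ) 1 :=
  ⟨le_min zero_le_one (le_max_left _ _), min_le_left _ _⟩

theorem lt_trunc_iff {c r : ℝ} (h0 : 0 ≤ c) (h1 : c < 1) : c < trunc r ↔ c < r := by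
  simp [trunc, h1, h0.not_gt]

theorem ENNReal.le_ofReal_trunc {a : ℝ≥0∞} {r : ℝ} (h1 : a ≤ 1) (hr : a ≤ ENNReal.ofReal r) :
    a ≤ ENNReal.ofReal (trunc r) := by
  have ha : a ≠ ∞ := ne_top_of_le_ne_top ENNReal.one_ne_top h1
  rw [trunc, ENNReal.ofReal_min, ENNReal.ofReal_one, ENNReal.ofReal_max, ENNReal.ofReal_zero]
  exact le_min h1 (hr.trans (le_max_right _ _))

end trunc

namespace IsLifting

variable {X₁ X₂ : Type*} [MeasurableSpace X₁] [MeasurableSpace X₂] {R : Set (X₁ × X₂)} {δ : ℝ}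
  {Δ : Measure X₁} {Θ : Measure X₂} {W : Measure (X₁ × X₂)}

theorem map_fst (h : IsLifting R δ Δ Θ W) : W.map Prod.fst = Δ := by
  ext s hs
  rw [Measure.map_apply measurable_fst hs, ← h.fst_marginal s hs, prod_univ]

theorem map_snd (h : IsLifting R δ Δ Θ W) : W.map Prod.snd = Θ := by
  ext s hs
  rw [Measure.map_apply measurable_snd hs, ← h.snd_marginal s hs, univ_prod]

/-- If `φ ≤ ψ` along the relation of a `δ`-lifting, then the integral of `φ` exceeds the one of `ψ`
by at most `δ`. -/
theorem lintegral_le_ofReal_trunc (h : IsLifting R δ Δ Θ W) (hR : MeasurableSet R)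
    {φ : X₁ → ℝ≥0∞} {ψ : X₂ → ℝ} (hφ : AEMeasurable φ Δ) (hψ : Integrable ψ Θ)
    (hφ1 : ∀ x, φ x ≤ 1) (hψ0 : ∀ x, 0 ≤ ψ x)
    (hle : ∀ x₁ x₂, (x₁, x₂) ∈ R → φ x₁ ≤ ENNReal.ofReal (ψ x₂)) :
    ∫⁻ x, φ x ∂Δ ≤ ENNReal.ofReal (trunc ((∫ x, ψ x ∂Θ) + δ)) := by
  have := h.isProbabilityMeasure
  have hcompl : W.real Rᶜ ≤ δ := by
    have := h.relation_prob
    rw [probReal_compl_eq_one_sub hR]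
    linarith
  have hδ : 0 ≤ δ := measureReal_nonneg.trans hcompl
  rw [← h.map_fst] at hφ ⊢
  rw [← h.map_snd] at hψ ⊢
  rw [lintegral_map' hφ measurable_fst.aemeasurable]
  refine ENNReal.le_ofReal_trunc ?_ ?_
  · calc ∫⁻ p, φ p.1 ∂W ≤ ∫⁻ _, 1 ∂W := lintegral_mono fun p => hφ1 p.1
      _ = 1 := by simp
  calc ∫⁻ p, φ p.1 ∂W
      -- Off `R` only `φ ≤ 1` is available; that part has mass at most `δ`.
      ≤ ∫⁻ p, (ENNReal.ofReal (ψ p.2) + Rᶜ.indicator 1 p) ∂W := by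
        refine lintegral_mono fun p => ?_
        by_cases hp : p ∈ R
        · exact (hle p.1 p.2 hp).trans le_self_add
        · refine (hφ1 p.1).trans ?_
          simp [hp]
    _ = ENNReal.ofReal (∫ x, ψ x ∂W.map Prod.snd) + ENNReal.ofReal (W.real Rᶜ) := by
        rw [lintegral_add_right _ (measurable_one.indicator hR.compl),
          lintegral_indicator_one hR.compl, ofReal_measureReal,
          ofReal_integral_eq_lintegral_ofReal hψ (.of_forall hψ0),
          lintegral_map' hψ.1.aemeasurable.ennreal_ofReal measurable_snd.aemeasurable]
    _ ≤ ENNReal.ofReal ((∫ x, ψ x ∂W.map Prod.snd) + δ) := by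
        rw [ENNReal.ofReal_add (integral_nonneg hψ0) hδ]
        gcongr

end IsLifting

/-! ### One-step laws, path laws and the backward recursion. -/

namespace GMDP

attribute [instance] GMDP.isMarkovKernel_trans

section Step

variable {X A Y : Type*} [MeasurableSpace X] [MeasurableSpace A] [MeasurableSpace Y]
  (M : GMDP X A Y)

theorem measurable_trans_prodMk (x : X) : Measurable fun u => M.trans (x, u) :=
  M.trans.measurable.comp measurable_prodMk_left

instance isProbabilityMeasure_step (x : X) (p : Measure A) [IsProbabilityMeasure p] :
    IsProbabilityMeasure (M.step x p) :=
  isProbabilityMeasure_bind (M.measurable_trans_prodMk x).aemeasurable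
    (.of_forall fun _ => inferInstance)

theorem measurable_step {Ω : Type*} [MeasurableSpace Ω] {f : Ω → X} (hf : Measurable f)
    {a : Ω → ProbabilityMeasure A} (ha : Measurable a) :
    Measurable fun ω => M.step (f ω) (a ω) := by
  refine Measure.measurable_of_measurable_coe _ fun s hs => ?_
  let κ : Kernel Ω A := ⟨fun ω => (a ω : Measure A), measurable_subtype_coe.comp ha⟩
  have : IsMarkovKernel κ := ⟨fun ω => (a ω).2⟩
  have hT : Measurable fun p : Ω × A => M.trans (f p.1, p.2) s :=
    (M.trans.measurable_coe hs).comp ((hf.comp measurable_fst).prodMk measurable_snd)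
  have h : Measurable fun ω => ∫⁻ u, M.trans (f ω, u) s ∂(κ ω) := hT.lintegral_kernel_prod_right'
  convert h using 2 with ω
  exact Measure.bind_apply hs (M.measurable_trans_prodMk (f ω)).aemeasurable

theorem aemeasurable_step [StandardBorelSpace A] {a : X → ProbabilityMeasure A}
    (ha : UniversallyMeasurable a) (m : Measure X) [IsProbabilityMeasure m] :
    AEMeasurable (fun x => M.step x (a x)) m := by
  have h := ha.aemeasurable m
  exact ⟨_, M.measurable_step measurable_id h.measurable_mk,
    h.ae_eq_mk.mono fun x hx => by simp only [hx, id]⟩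

theorem universallyMeasurable_lintegral_step [StandardBorelSpace A] {a : X → ProbabilityMeasure A}
    (ha : UniversallyMeasurable a) {φ : X → ℝ≥0∞} (hφ : UniversallyMeasurable φ) :
    UniversallyMeasurable fun x => ∫⁻ y, φ y ∂(M.step x (a x)) := by
  refine .of_aemeasurable fun m _ => ?_
  have hs := M.aemeasurable_step ha m
  -- Universal measurability of `φ` is used at the mixture of the one-step laws.
  have : IsProbabilityMeasure (m.bind fun x => M.step x (a x)) :=
    isProbabilityMeasure_bind hs (.of_forall fun _ => inferInstance)
  exact (Measure.aemeasurable_lintegral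
    (hφ.aemeasurable (m.bind fun x => M.step x (a x)))).comp_aemeasurable hs

end Step

section HitIntegrand

variable {Ω : Type*} {D : Set Ω}

/-- The function that is `1` on `D` and equals `q` off `D`. -/
noncomputable def hitIntegrand (D : Set Ω) (q : Ω → ℝ≥0∞) (ω : Ω) : ℝ≥0∞ :=
  D.indicator 1 ω + Dᶜ.indicator q ω

theorem hitIntegrand_of_mem (q : Ω → ℝ≥0∞) {ω : Ω} (h : ω ∈ D) :
    hitIntegrand D q ω = 1 := by simp [hitIntegrand, h]

theorem hitIntegrand_of_notMem (q : Ω → ℝ≥0∞) {ω : Ω} (h : ω ∉ D) :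
    hitIntegrand D q ω = q ω := by simp [hitIntegrand, h]

theorem hitIntegrand_le_one (D : Set Ω) {q : Ω → ℝ≥0∞} (hq : ∀ ω, q ω ≤ 1) (ω : Ω) :
    hitIntegrand D q ω ≤ 1 := by
  by_cases h : ω ∈ D
  · rw [hitIntegrand_of_mem _ h]
  · rw [hitIntegrand_of_notMem _ h]
    exact hq ω

theorem aemeasurable_hitIntegrand [MeasurableSpace Ω]
    (hD : MeasurableSet D) {q : Ω → ℝ≥0∞} {m : Measure Ω} (hq : AEMeasurable q m) :
    AEMeasurable (hitIntegrand D q) m :=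
  (aemeasurable_one.indicator hD).add (hq.indicator hD.compl)

end HitIntegrand

section HitSet

variable {X : Type*} {D : Set X}

/-- The paths of length `n` that are in `D` at some time. -/
def hitSet (D : Set X) (n : ℕ) : Set (Fin (n + 1) → X) := {ω | ∃ t, ω t ∈ D}

theorem snoc_mem_hitSet {n : ℕ} {ω : Fin (n + 1) → X} {x : X} :
    (Fin.snoc ω x : Fin (n + 2) → X) ∈ hitSet D (n + 1) ↔ ω ∈ hitSet D n ∨ x ∈ D := by
  simp [hitSet, Fin.exists_fin_succ']

theorem hitIntegrand_snoc (q : X → ℝ≥0∞) {n : ℕ} (ω : Fin (n + 1) → X) (x : X) :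
    hitIntegrand (hitSet D (n + 1)) (fun ω' => q (ω' (Fin.last (n + 1))))
      (Fin.snoc ω x : Fin (n + 2) → X) =
    hitIntegrand (hitSet D n) (fun _ => hitIntegrand D q x) ω := by
  by_cases hω : ω ∈ hitSet D n
  · rw [hitIntegrand_of_mem _ hω, hitIntegrand_of_mem _ (snoc_mem_hitSet.2 (.inl hω))]
  rw [hitIntegrand_of_notMem _ hω]
  by_cases hx : x ∈ D
  · rw [hitIntegrand_of_mem _ hx, hitIntegrand_of_mem _ (snoc_mem_hitSet.2 (.inr hx))]
  · rw [hitIntegrand_of_notMem _ hx, hitIntegrand_of_notMem _ (by simp [snoc_mem_hitSet, hω, hx]),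
      Fin.snoc_last]

end HitSet

section HitProb

variable {X A Y : Type*} [MeasurableSpace X] [MeasurableSpace A] [MeasurableSpace Y]
  (M : GMDP X A Y) (μ : MarkovPolicy X A) (D : Set X)

/-- The probability that the state is in `D` at some time in `{t + 1, …, t + j}`, given the state
at time `t`. -/
noncomputable def hitProb : ℕ → ℕ → X → ℝ≥0∞
  | 0, _, _ => 0
  | j + 1, t, x => ∫⁻ y, hitIntegrand D (hitProb j (t + 1)) y ∂(M.step x (μ.act t x))

theorem hitProb_le_one (j t : ℕ) (x : X) : M.hitProb μ D j t x ≤ 1 := by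
  induction j generalizing t x with
  | zero => exact zero_le_one
  | succ j ih =>
    exact (lintegral_mono fun y => hitIntegrand_le_one D (ih (t + 1)) y).trans (by simp)

variable {D}

theorem universallyMeasurable_hitProb [StandardBorelSpace A] (hD : MeasurableSet D) (j t : ℕ) :
    UniversallyMeasurable (M.hitProb μ D j t) := by
  induction j generalizing t with
  | zero => exact .const 0
  | succ j ih =>
    exact M.universallyMeasurable_lintegral_step (μ.universallyMeasurable_act t)
      (.of_aemeasurable fun m _ => aemeasurable_hitIntegrand hD ((ih (t + 1)).aemeasurable m))

theorem measurable_snoc (n : ℕ) :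
    Measurable fun p : (Fin (n + 1) → X) × X => (Fin.snoc p.1 p.2 : Fin (n + 2) → X) := by
  refine measurable_pi_lambda _ fun i => ?_
  refine Fin.lastCases ?_ (fun i => ?_) i
  · simpa using! measurable_snd
  · simpa using! (measurable_pi_apply i).comp measurable_fst

theorem aemeasurable_pathStep [StandardBorelSpace A] (n : ℕ) (m : Measure (Fin (n + 1) → X))
    [IsProbabilityMeasure m] :
    AEMeasurable (fun ω => (M.step (ω (Fin.last n)) (μ.act n (ω (Fin.last n)))).map
      fun x' => (Fin.snoc ω x' : Fin (n + 2) → X)) m := by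
  have hlast : Measurable fun ω : Fin (n + 1) → X => ω (Fin.last n) := measurable_pi_apply _
  have ha := (μ.universallyMeasurable_act n).aemeasurable_comp hlast m
  let κ : Kernel (Fin (n + 1) → X) X := ⟨fun ω => M.step (ω (Fin.last n)) (ha.mk _ ω),
    M.measurable_step hlast ha.measurable_mk⟩
  have : IsMarkovKernel κ := ⟨fun ω => M.isProbabilityMeasure_step _ _⟩
  refine ⟨fun ω => (κ ω).map fun x' => (Fin.snoc ω x' : Fin (n + 2) → X), ?_, ?_⟩
  · refine Measure.measurable_of_measurable_coe _ fun s hs => ?_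
    convert Kernel.measurable_kernel_prodMk_left (κ := κ) (measurable_snoc n hs) using 2 with ω
    exact Measure.map_apply ((measurable_snoc n).comp measurable_prodMk_left) hs
  · filter_upwards [ha.ae_eq_mk] with ω hω
    simp only [κ, Kernel.coe_mk, ← hω]

instance isProbabilityMeasure_pathLaw [StandardBorelSpace A] (n : ℕ) :
    IsProbabilityMeasure (M.pathLaw μ n) := by
  induction n with
  | zero => exact Measure.isProbabilityMeasure_map (by fun_prop)
  | succ n ih =>
    refine isProbabilityMeasure_bind (M.aemeasurable_pathStep μ n _) (.of_forall fun ω => ?_)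
    exact Measure.isProbabilityMeasure_map
      ((measurable_snoc n).comp measurable_prodMk_left).aemeasurable

theorem measurableSet_hitSet (hD : MeasurableSet D) (n : ℕ) : MeasurableSet (hitSet D n) := by
  have : hitSet D n = ⋃ t, (fun ω : Fin (n + 1) → X => ω t) ⁻¹' D := by
    ext ω
    simp [hitSet]
  rw [this]
  exact .iUnion fun t => measurable_pi_apply t hD

/-- This is the Markov property: one step of the path law is traded for one step of the recursion,
leaving the integral unchanged. -/
theorem lintegral_pathLaw_succ [StandardBorelSpace A] (hD : MeasurableSet D) (j n : ℕ) :
    ∫⁻ ω, hitIntegrand (hitSet D (n + 1))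
          (fun ω' => M.hitProb μ D j (n + 1) (ω' (Fin.last (n + 1)))) ω
        ∂(M.pathLaw μ (n + 1)) =
      ∫⁻ ω, hitIntegrand (hitSet D n) (fun ω' => M.hitProb μ D (j + 1) n (ω' (Fin.last n))) ω
        ∂(M.pathLaw μ n) := by
  have hq := M.universallyMeasurable_hitProb μ hD j (n + 1)
  have hmeas : AEMeasurable (hitIntegrand (hitSet D (n + 1))
      (fun ω' => M.hitProb μ D j (n + 1) (ω' (Fin.last (n + 1))))) (M.pathLaw μ (n + 1)) :=
    aemeasurable_hitIntegrand (measurableSet_hitSet hD _)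
      (hq.aemeasurable_comp (measurable_pi_apply _) _)
  have hstep := M.aemeasurable_pathStep μ n (M.pathLaw μ n)
  have hae := hstep.ae_of_bind hmeas
  rw [pathLaw, Measure.lintegral_bind hstep hmeas]
  refine lintegral_congr_ae ?_
  filter_upwards [hae] with ω hω
  rw [lintegral_map' hω ((measurable_snoc n).comp measurable_prodMk_left).aemeasurable]
  simp only [hitIntegrand_snoc]
  by_cases h : ω ∈ hitSet D n
  · simp only [hitIntegrand_of_mem _ h]
    simp
  · simp only [hitIntegrand_of_notMem _ h]
    rfl

theorem lintegral_pathLaw_eq_measure_hitSet [StandardBorelSpace A] (hD : MeasurableSet D)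
    {j n N : ℕ} (h : n + j = N) :
    ∫⁻ ω, hitIntegrand (hitSet D n) (fun ω' => M.hitProb μ D j n (ω' (Fin.last n))) ω
        ∂(M.pathLaw μ n) = M.pathLaw μ N (hitSet D N) := by
  induction j generalizing n with
  | zero =>
    obtain rfl : n = N := h
    rw [← lintegral_indicator_one (measurableSet_hitSet hD n)]
    refine lintegral_congr fun ω => ?_
    simp [hitIntegrand, hitProb]
  | succ j ih =>
    rw [← lintegral_pathLaw_succ _ _ hD, ih (by omega)]

/-- The probability to be in `D` up to time `N`, in terms of the backward recursion. -/
theorem measure_hitSet_eq_lintegral_init [StandardBorelSpace A] (hD : MeasurableSet D) (N : ℕ) :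
    M.pathLaw μ N (hitSet D N) =
      ∫⁻ x, hitIntegrand D (M.hitProb μ D N 0) x ∂(M.init : Measure X) := by
  have hmeas := aemeasurable_hitIntegrand (measurableSet_hitSet hD 0)
    ((M.universallyMeasurable_hitProb μ hD N 0).aemeasurable_comp
      (measurable_pi_apply (Fin.last 0)) (M.pathLaw μ 0))
  rw [← M.lintegral_pathLaw_eq_measure_hitSet μ hD (zero_add N), pathLaw,
    lintegral_map' hmeas (by fun_prop)]
  refine lintegral_congr fun x => ?_
  by_cases hx : x ∈ D <;> simp [hitIntegrand, hitSet, hx]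

end HitProb

/-! ### The truncated Bellman operator. -/

section UpperOp

variable {X A Y : Type*} [MeasurableSpace X] [MeasurableSpace A] [MeasurableSpace Y]
  (M : GMDP X A Y) {D : Set X} {V : X → ℝ}

theorem upperOp_mem_Icc (D : Set X) (δ : ℝ) (ν : X → ProbabilityMeasure A) (V : X → ℝ) (x : X) :
    M.upperOp D δ ν V x ∈ Icc (0 : ℝ) 1 := trunc_mem_Icc _

theorem upperOp_le_upperBellman (D : Set X) (δ : ℝ) {ν : X → ProbabilityMeasure A}
    (hν : UniversallyMeasurable ν) (V : X → ℝ) (x : X) :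
    M.upperOp D δ ν V x ≤ M.upperBellman D δ V x :=
  le_ciSup (f := fun ν : {ν : X → ProbabilityMeasure A // UniversallyMeasurable ν} =>
      M.upperOp D δ ν V x)
    ⟨1, by rintro _ ⟨ν, rfl⟩; exact (M.upperOp_mem_Icc D δ ν V x).2⟩ ⟨ν, hν⟩

theorem upperBellman_mem_Icc (D : Set X) (δ : ℝ) (V : X → ℝ) (x : X) :
    M.upperBellman D δ V x ∈ Icc (0 : ℝ) 1 :=
  ⟨Real.iSup_nonneg fun ν => (M.upperOp_mem_Icc D δ ν V x).1,
    Real.iSup_le (fun ν => (M.upperOp_mem_Icc D δ ν V x).2) zero_le_one⟩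

theorem exists_lt_integral_trans [TopologicalSpace X] [PolishSpace X] [BorelSpace X] {g : X → ℝ}
    (hg : UpperSemianalytic g) (h01 : ∀ x, g x ∈ Icc (0 : ℝ) 1) {x : X}
    {p : Measure A} [IsProbabilityMeasure p] {c : ℝ}
    (hc0 : c < ∫ y, g y ∂(M.step x p)) : ∃ u, c < ∫ y, g y ∂(M.trans (x, u)) := by
  by_contra! hle
  refine hc0.not_ge ?_
  -- Some control exists, so the assumed bound forces `0 ≤ c`, as the passage to `ℝ≥0∞` requires.
  obtain ⟨u₀⟩ := p.nonempty_of_neZero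
  have hc : 0 ≤ c := (integral_nonneg fun y => (h01 y).1).trans (hle u₀)
  have hnn : ∀ y, 0 ≤ g y := fun y => (h01 y).1
  rw [integral_eq_lintegral_of_nonneg_ae (.of_forall hnn)
    (hg.aemeasurable _).aestronglyMeasurable]
  refine ENNReal.toReal_le_of_le_ofReal hc ?_
  rw [step, Measure.lintegral_bind (M.measurable_trans_prodMk x).aemeasurable
    (hg.aemeasurable (M.step x p)).ennreal_ofReal]
  calc ∫⁻ u, ∫⁻ y, ENNReal.ofReal (g y) ∂(M.trans (x, u)) ∂p ≤ ∫⁻ _, ENNReal.ofReal c ∂p := by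
        refine lintegral_mono fun u => ?_
        rw [← ofReal_integral_eq_lintegral_ofReal (hg.integrable h01 _) (.of_forall hnn)]
        exact ENNReal.ofReal_le_ofReal (hle u)
    _ = ENNReal.ofReal c := by simp

end UpperOp

section ReachIntegrand

variable {X : Type*} {D : Set X} {V : X → ℝ}

theorem reachIntegrand_of_mem (V : X → ℝ) {x : X} (h : x ∈ D) :
    reachIntegrand D V x = 1 := by simp [reachIntegrand, h]

theorem reachIntegrand_of_notMem (V : X → ℝ) {x : X} (h : x ∉ D) :
    reachIntegrand D V x = V x := by simp [reachIntegrand, h]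

theorem reachIntegrand_mem_Icc (hV : ∀ x, V x ∈ Icc (0 : ℝ) 1) (x : X) :
    reachIntegrand D V x ∈ Icc (0 : ℝ) 1 := by
  by_cases h : x ∈ D
  · simp [reachIntegrand_of_mem _ h]
  · rw [reachIntegrand_of_notMem _ h]
    exact hV x

theorem upperSemianalytic_reachIntegrand [TopologicalSpace X] (hD : AnalyticSet D)
    (hV : UpperSemianalytic V) (h01 : ∀ x, V x ∈ Icc (0 : ℝ) 1) :
    UpperSemianalytic (reachIntegrand D V) := by
  intro c
  rcases lt_or_ge c 1 with hc | hc
  · convert hD.union (hV c) using 1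
    ext x
    by_cases h : x ∈ D
    · simp [reachIntegrand_of_mem _ h, h, hc]
    · simp [reachIntegrand_of_notMem _ h, h]
  · convert analyticSet_empty (α := X)
    exact eq_empty_of_forall_notMem fun x hx =>
      (hx.trans_le ((reachIntegrand_mem_Icc h01 x).2.trans hc)).false

end ReachIntegrand

section LtUpperBellman

variable {X A Y : Type*} [MeasurableSpace X] [MeasurableSpace A] [MeasurableSpace Y]
  (M : GMDP X A Y) {D : Set X} {V : X → ℝ}

/-- For `c` in `[0, 1)` truncation does not affect the strict inequality. A mixed control cannot
beat all pure ones, and each pure control is realised by a constant Dirac rule. -/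
theorem lt_upperBellman_iff [TopologicalSpace X] [PolishSpace X] [BorelSpace X]
    (hD : AnalyticSet D) (hV : UpperSemianalytic V)
    (h01 : ∀ x, V x ∈ Icc (0 : ℝ) 1) (δ : ℝ) {c : ℝ} (hc0 : 0 ≤ c) (hc1 : c < 1) (x : X) :
    c < M.upperBellman D δ V x ↔
      ∃ u, c - δ < ∫ y, reachIntegrand D V y ∂(M.trans (x, u)) := by
  constructor
  · intro h
    obtain ⟨ν, hν⟩ : ∃ ν : {ν : X → ProbabilityMeasure A // UniversallyMeasurable ν},
        c < M.upperOp D δ ν V x := by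
      by_contra! hle
      exact h.not_ge (Real.iSup_le hle hc0)
    rw [upperOp, lt_trunc_iff hc0 hc1, ← sub_lt_iff_lt_add] at hν
    exact M.exists_lt_integral_trans (upperSemianalytic_reachIntegrand hD hV h01)
      (reachIntegrand_mem_Icc h01) hν
  · rintro ⟨u, hu⟩
    refine lt_of_lt_of_le ?_ (M.upperOp_le_upperBellman D δ
      (ν := fun _ => ⟨Measure.dirac u, inferInstance⟩) (.const _) V x)
    refine (lt_trunc_iff hc0 hc1).2 (sub_lt_iff_lt_add.1 ?_)
    convert hu using 2
    exact Measure.dirac_bind (M.measurable_trans_prodMk x) u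

end LtUpperBellman

section Bellman

variable {X A Y : Type*} [TopologicalSpace X] [PolishSpace X] [MeasurableSpace X] [BorelSpace X]
  [TopologicalSpace A] [PolishSpace A] [MeasurableSpace A] [BorelSpace A] [MeasurableSpace Y]
  (M : GMDP X A Y) {D : Set X} {V : X → ℝ}

/-- The truncated Bellman operator preserves upper semianalytic functions. -/
theorem upperSemianalytic_upperBellman (hD : AnalyticSet D) (hV : UpperSemianalytic V)
    (h01 : ∀ x, V x ∈ Icc (0 : ℝ) 1) (δ : ℝ) : UpperSemianalytic (M.upperBellman D δ V) := by
  intro c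
  rcases lt_or_ge c 0 with hc0 | hc0
  · convert (MeasurableSet.univ (α := X)).analyticSet
    exact eq_univ_of_forall fun x => hc0.trans_le (M.upperBellman_mem_Icc D δ V x).1
  rcases lt_or_ge c 1 with hc1 | hc1
  · have h := (upperSemianalytic_reachIntegrand hD hV h01).integral_kernel
      (reachIntegrand_mem_Icc h01) M.trans
    -- The level set is a projection along the control space.
    convert (h (c - δ)).image_of_continuous continuous_fst using 1
    ext x
    simp [M.lt_upperBellman_iff hD hV h01 δ hc0 hc1 x]
  · convert analyticSet_empty (α := X)
    exact eq_empty_of_forall_notMem fun x hx =>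
      (hx.trans_le ((M.upperBellman_mem_Icc D δ V x).2.trans hc1)).false

end Bellman

end GMDP

/-! ### The dilated target and the main theorem. -/

theorem analyticSet_dilation {Y : Type*} [MetricSpace Y] [PolishSpace Y] [MeasurableSpace Y]
    [BorelSpace Y] (ε : ℝ) {K : Set Y} (hK : MeasurableSet K) : AnalyticSet (dilation ε K) := by
  have hclosed : IsClosed {p : Y × Y | dist p.1 p.2 ≤ ε} :=
    isClosed_le continuous_dist continuous_const
  convert ((measurable_fst hK).analyticSet.inter hclosed.analyticSet).image_of_continuous
    (continuous_snd (X := Y) (Y := Y)) using 1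
  ext z
  simp [dilation]

theorem theorem2 {X₁ A₁ X₂ A₂ Y : Type*}
    [TopologicalSpace X₁] [PolishSpace X₁] [MeasurableSpace X₁] [BorelSpace X₁]
    [TopologicalSpace A₁] [PolishSpace A₁] [MeasurableSpace A₁] [BorelSpace A₁]
    [TopologicalSpace X₂] [PolishSpace X₂] [MeasurableSpace X₂] [BorelSpace X₂]
    [TopologicalSpace A₂] [PolishSpace A₂] [MeasurableSpace A₂] [BorelSpace A₂]
    [MetricSpace Y] [PolishSpace Y] [MeasurableSpace Y] [BorelSpace Y]
    (M₁ : GMDP X₁ A₁ Y) (M₂ : GMDP X₂ A₂ Y) (ε δ : ℝ)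
    (hsim : GMDP.IsSimulatedBy ε δ M₂ M₁)
    (K : Set Y) (hK : MeasurableSet K) (N : ℕ)
    (V : ℕ → X₁ → ℝ) (hVN : V N = fun _ => 0)
    (hV : ∀ k, k < N →
      V k = M₁.upperBellman (M₁.out ⁻¹' dilation ε K) δ (V (k + 1))) :
    UniversallyMeasurableSet (M₁.out ⁻¹' dilation ε K) ∧
    (∀ k, k ≤ N → UniversallyMeasurable (V k) ∧ ∀ x, V k x ∈ Set.Icc (0 : ℝ) 1) ∧
    ∀ μ : MarkovPolicy X₂ A₂,
      M₂.reachProb μ K N ≤ M₁.upperReach (M₁.out ⁻¹' dilation ε K) δ (V 0) := by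
  set D := M₁.out ⁻¹' dilation ε K with hDdef
  have hD : AnalyticSet D := (analyticSet_dilation ε hK).preimage_of_measurable M₁.measurable_out
  have hVk : ∀ j k, k + j = N → UpperSemianalytic (V k) ∧ ∀ x, V k x ∈ Icc (0 : ℝ) 1 := by
    intro j
    induction j with
    | zero =>
      rintro k rfl
      rw [add_zero] at hVN
      rw [hVN]
      exact ⟨fun c => (measurableSet_lt measurable_const measurable_const).analyticSet,
        fun _ => ⟨le_rfl, zero_le_one⟩⟩
    | succ j ih =>
      intro k hk
      obtain ⟨h1, h2⟩ := ih (k + 1) (by omega)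
      rw [hV k (by omega)]
      exact ⟨M₁.upperSemianalytic_upperBellman hD h1 h2 δ, M₁.upperBellman_mem_Icc D δ _⟩
  refine ⟨fun m _ => hD.nullMeasurableSet m, fun k hk => ?_, fun μ => ?_⟩
  · obtain ⟨h1, h2⟩ := hVk (N - k) k (by omega)
    exact ⟨fun m _ => h1.nullMeasurable m, h2⟩
  obtain ⟨U, R, W, hU, hW, hR, hout, hlift, W₀, hW₀⟩ := hsim
  set E := M₂.out ⁻¹' K with hEdef
  have hE : MeasurableSet E := M₂.measurable_out hK
  have hRD : ∀ x₂ x₁, (x₂, x₁) ∈ R → x₂ ∈ E → x₁ ∈ D := fun x₂ x₁ h hx =>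
    ⟨_, hx, hout x₂ x₁ h⟩
  have hintegrand : ∀ (q : X₂ → ℝ≥0∞) (v : X₁ → ℝ), (∀ x, q x ≤ 1) →
      (∀ x₂ x₁, (x₂, x₁) ∈ R → q x₂ ≤ ENNReal.ofReal (v x₁)) → ∀ x₂ x₁, (x₂, x₁) ∈ R →
      GMDP.hitIntegrand E q x₂ ≤ ENNReal.ofReal (GMDP.reachIntegrand D v x₁) := by
    intro q v hq hqv x₂ x₁ hx
    by_cases hx₁ : x₁ ∈ D
    · rw [GMDP.reachIntegrand_of_mem _ hx₁, ENNReal.ofReal_one]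
      exact GMDP.hitIntegrand_le_one E hq x₂
    · rw [GMDP.reachIntegrand_of_notMem _ hx₁,
        GMDP.hitIntegrand_of_notMem _ fun h => hx₁ (hRD x₂ x₁ hx h)]
      exact hqv x₂ x₁ hx
  -- The pair `(Δ, Θ)` is left general so that the same estimate serves both the transitions and the
  -- initial laws.
  have hcmp : ∀ (j k : ℕ), k + j = N → ∀ {Δ : Measure X₂} {Θ : Measure X₁} {w},
      IsLifting R δ Δ Θ w → IsProbabilityMeasure Δ → IsProbabilityMeasure Θ →
      (∀ x₂ x₁, (x₂, x₁) ∈ R → M₂.hitProb μ E j k x₂ ≤ ENNReal.ofReal (V k x₁)) →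
      ∫⁻ x, GMDP.hitIntegrand E (M₂.hitProb μ E j k) x ∂Δ ≤
        ENNReal.ofReal (trunc ((∫ x, GMDP.reachIntegrand D (V k) x ∂Θ) + δ)) := by
    intro j k hk Δ Θ w hw _ _ hle
    obtain ⟨h1, h2⟩ := hVk j k hk
    have hq := M₂.hitProb_le_one μ E j k
    exact hw.lintegral_le_ofReal_trunc hR
      (GMDP.aemeasurable_hitIntegrand hE
        ((M₂.universallyMeasurable_hitProb μ hE j k).aemeasurable Δ))
      ((GMDP.upperSemianalytic_reachIntegrand hD h1 h2).integrable
        (GMDP.reachIntegrand_mem_Icc h2) Θ)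
      (GMDP.hitIntegrand_le_one E hq) (fun x => (GMDP.reachIntegrand_mem_Icc h2 x).1)
      (hintegrand _ _ hq hle)
  have hrec : ∀ j k, k + j = N → ∀ x₂ x₁, (x₂, x₁) ∈ R →
      M₂.hitProb μ E j k x₂ ≤ ENNReal.ofReal (V k x₁) := by
    intro j
    induction j with
    | zero => exact fun _ _ _ _ _ => zero_le
    | succ j ih =>
      intro k hk x₂ x₁ hx
      have hmeas := GMDP.aemeasurable_hitIntegrand hE
        ((M₂.universallyMeasurable_hitProb μ hE j (k + 1)).aemeasurable
          (M₂.step x₂ (μ.act k x₂)))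
      rw [GMDP.hitProb, GMDP.step,
        Measure.lintegral_bind (M₂.measurable_trans_prodMk x₂).aemeasurable hmeas]
      calc _ ≤ ∫⁻ _, ENNReal.ofReal (V k x₁) ∂(μ.act k x₂ : Measure A₂) := by
            refine lintegral_mono fun u => ?_
            refine (hcmp j (k + 1) (by omega) (hlift x₂ x₁ hx u) inferInstance
              inferInstance (ih (k + 1) (by omega))).trans (ENNReal.ofReal_le_ofReal ?_)
            rw [hV k (by omega)]
            -- The control `u` and both states are fixed here, so the interface output is a constant
            -- rule.
            exact M₁.upperOp_le_upperBellman D δ (ν := fun _ => ⟨U (u, x₂, x₁), inferInstance⟩)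
              (.const _) (V (k + 1)) x₁
        _ = ENNReal.ofReal (V k x₁) := by simp
  refine ENNReal.toReal_le_of_le_ofReal (trunc_mem_Icc _).1 ?_
  refine (M₂.measure_hitSet_eq_lintegral_init μ hE N).trans_le ?_
  exact hcmp N 0 (zero_add N) hW₀ inferInstance inferInstance (hrec N 0 (zero_add N))
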